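/- Let $\mathbb T$ be a (finitary, one-sorted) Mal'tsev theory, i.e. an algebraic theory containing a ternary term $p$ for which the identities $p(x,x,y)=y$ and $p(x,y,y)=x$ hold. Let $\mathbb T(\mathbf{HComp})$ be the category of compact Hausdorff $\mathbb T$-algebras and continuous homomorphisms, and let $\mathbb T(\mathbf{Profin})$ be its full subcategory of profinite (= compact Hausdorff totally disconnected) algebras. For an algebra $A$ in $\mathbb T(\mathbf{HComp})$ let $R_A$ be the relation on $A$ that identifies two points when they lie in the same connected component. 1. $\mathbb T(\mathbf{Profin})$ is a Birkhoff subcategory of the category $\mathbb T(\mathbf{HComp})$. That is: $\mathbb T(\mathbf{HComp})$ is exact (finitely complete, regular, and every internal equivalence relation is effective); $\mathbb T(\mathbf{Profin})$ is a full replete reflective subcategory all of whose reflection units are regular epimorphisms; and if $f\colon X\to Y$ is a regular epimorphism in $\mathbb T(\mathbf{HComp})$ with $X$ profinite, then $Y$ is profinite. Moreover, for each $A$ in $\mathbb T(\mathbf{HComp})$, the relation $R_A$ is a congruence on $A$ (an equivalence relation which is a closed subalgebra of $A\times A$), and the unit $\eta_A$ of the reflection is the quotient map $A\to A/R_A$: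 it is a topological quotient map, and $\eta_A(x)=\eta_A(y)$ if and only if $(x,y)\in R_A$. 2. For an internal equivalence relation $S$ on an object $A$ of $\mathbb T(\mathbf{HComp})$, with quotient (coequalizer) $q\colon A\to A/S$, the effective closure $\overline S$ of $S$ associated with this reflection is the kernel pair of $\eta_{A/S}\circ q$. It exists and is given by $$\overline S \;=\; S\circ R_A \;=\; R_A\circ S .$$ -/

import Mathlib

open CategoryTheory CategoryTheory.Limits

universe w v u

namespace MaltsevAlg

/-! ### Algebraic theories -/

/-- The purely functional first-order language with set `Op n` of `n`-ary operation symbols. -/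
abbrev opLanguage (Op : ℕ → Type u) : FirstOrder.Language.{u, 0} :=
  ⟨Op, fun _ => Empty⟩

/-- A (finitary, one-sorted) algebraic theory, presented by operation symbols and equations
between terms in the variables `x₀, x₁, x₂, …`. -/
structure AlgTheory where
  /-- The `n`-ary operation symbols. -/
  Op : ℕ → Type u
  /-- The equational axioms; `(s, t)` stands for the equation `s = t`. -/
  Ax : Set ((opLanguage Op).Term ℕ × (opLanguage Op).Term ℕ)

namespace AlgTheory

/-- The language of an algebraic theory. -/
abbrev lang (T : AlgTheory.{u}) : FirstOrder.Language.{u, 0} := opLanguage T.Op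

/-- `T.Proves s t`: the equation `s = t` belongs to the theory `T`, i.e. it is derivable from the
axioms of `T` in equational logic. -/
inductive Proves (T : AlgTheory.{u}) : T.lang.Term ℕ → T.lang.Term ℕ → Prop
  | ax {s t : T.lang.Term ℕ} (h : (s, t) ∈ T.Ax) (σ : ℕ → T.lang.Term ℕ) :
      Proves T (s.subst σ) (t.subst σ)
  | refl (t : T.lang.Term ℕ) : Proves T t t
  | symm {s t : T.lang.Term ℕ} : Proves T s t → Proves T t s
  | trans {s t r : T.lang.Term ℕ} : Proves T s t → Proves T t r → Proves T s r
  | congr {n : ℕ} (f : T.lang.Functions n) {s t : Fin n → T.lang.Term ℕ} :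
      (∀ i, Proves T (s i) (t i)) →
        Proves T (FirstOrder.Language.Term.func f s) (FirstOrder.Language.Term.func f t)

/-- `T` is a Mal'tsev theory: it contains a ternary term `p` such that the identities
`p(x,x,y) = y` and `p(x,y,y) = x` hold in `T`. -/
def IsMaltsev (T : AlgTheory.{u}) : Prop :=
  ∃ p : T.lang.Term (Fin 3),
    T.Proves (p.subst ![.var 0, .var 0, .var 1]) (.var 1) ∧
    T.Proves (p.subst ![.var 0, .var 1, .var 1]) (.var 0)

end AlgTheory

/-! ### Compact Hausdorff algebras -/

/-- A compact Hausdorff `T`-algebra: a compact Hausdorff space with continuous operations that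
satisfy the equations of `T`. The empty algebra is allowed (when it exists). -/
structure CompHausAlg (T : AlgTheory.{u}) where
  /-- The underlying type. -/
  carrier : Type w
  [top : TopologicalSpace carrier]
  [compact : CompactSpace carrier]
  [t2 : T2Space carrier]
  [str : T.lang.Structure carrier]
  continuous_op : ∀ {n : ℕ} (f : T.lang.Functions n),
    Continuous (FirstOrder.Language.Structure.funMap f : (Fin n → carrier) → carrier)
  satisfies : ∀ e ∈ T.Ax, ∀ x : ℕ → carrier, e.1.realize x = e.2.realize x

namespace CompHausAlg

variable {T : AlgTheory.{u}}

instance : CoeSort (CompHausAlg.{w} T) (Type w) := ⟨carrier⟩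

attribute [instance] top compact t2 str

/-- Morphisms of compact Hausdorff `T`-algebras: the continuous homomorphisms. -/
@[ext]
structure Hom (A B : CompHausAlg.{w} T) where
  /-- The underlying map. -/
  toFun : A → B
  continuous_toFun : Continuous toFun
  map_op : ∀ {n : ℕ} (f : T.lang.Functions n) (x : Fin n → A),
    toFun (FirstOrder.Language.Structure.funMap f x) =
      FirstOrder.Language.Structure.funMap f (fun i => toFun (x i))

instance (A B : CompHausAlg.{w} T) : FunLike (Hom A B) A B where
  coe := Hom.toFun
  coe_injective _ _ h := Hom.ext h

/-- The category of compact Hausdorff `T`-algebras. -/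
instance : Category.{w} (CompHausAlg.{w} T) where
  Hom := Hom
  id A := ⟨id, continuous_id, fun _ _ => rfl⟩
  comp f g := ⟨g.toFun ∘ f.toFun, g.continuous_toFun.comp f.continuous_toFun, fun o x => by
    simp only [Function.comp_apply, f.map_op, g.map_op]⟩

instance : ConcreteCategory (CompHausAlg.{w} T) Hom where
  hom f := f
  ofHom f := f

variable (T) in
/-- The full subcategory of profinite `T`-algebras: the compact Hausdorff `T`-algebras whose
underlying space is totally disconnected. -/
def profinite : ObjectProperty (CompHausAlg.{w} T) :=
  fun A => TotallyDisconnectedSpace A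

/-- The relation `R_A`: two points are related when they have the same connected component. -/
def compRel (A : CompHausAlg.{w} T) (x y : A) : Prop :=
  connectedComponent x = connectedComponent y

/-- A congruence on a compact Hausdorff algebra: an equivalence relation which is closed in
`A × A` and compatible with the operations. -/
structure IsCongruence (A : CompHausAlg.{w} T) (r : A → A → Prop) : Prop where
  equivalence : Equivalence r
  isClosed : IsClosed {z : A × A | r z.1 z.2}
  op_compat : ∀ {n : ℕ} (f : T.lang.Functions n) (x y : Fin n → A), (∀ i, r (x i) (y i)) →
    r (FirstOrder.Language.Structure.funMap f x) (FirstOrder.Language.Structure.funMap f y)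

/-- The relation on the points of `A` given by a parallel pair `s₁, s₂ : S ⟶ A`. -/
def relOf {S A : CompHausAlg.{w} T} (s₁ s₂ : S ⟶ A) (x y : A) : Prop :=
  ∃ s : S, s₁ s = x ∧ s₂ s = y

end CompHausAlg

/-! ### Exact categories, Birkhoff subcategories, effective closure -/

section Categorical

variable {C : Type u} [Category.{v} C]

variable (C) in
/-- A (Barr-)exact category: a finitely complete regular category in which every internal
equivalence relation is effective. -/
structure IsExact : Prop where
  regular : Regular C
  effective : ∀ {R X : C} (p₁ p₂ : R ⟶ X), IsEquivalenceRelation p₁ p₂ →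
    IsEffectiveEquivalenceRelation p₁ p₂

/-- An epireflective subcategory: a full replete reflective subcategory such that every component
of the unit of the reflection is a regular epimorphism. -/
structure IsEpireflective (P : ObjectProperty C) : Prop where
  replete : P.IsClosedUnderIsomorphisms
  reflective : Nonempty (Reflective P.ι)
  unit_regularEpi : ∀ [Reflective P.ι] (X : C),
    IsRegularEpi ((reflectorAdjunction P.ι).unit.app X)

/-- A Birkhoff subcategory of an exact category: an epireflective subcategory which is closed
under regular quotients. -/
structure IsBirkhoff (P : ObjectProperty C) : Prop where
  exact : IsExact C
  epireflective : IsEpireflective P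
  regular_quotient : ∀ {X Y : C} (f : X ⟶ Y), IsRegularEpi f → P X → P Y

/-- `t₁, t₂ : T ⟶ X` is the effective closure of the equivalence relation `s₁, s₂ : S ⟶ X` with
respect to the reflective subcategory `P`: with `q : X ⟶ Q` the quotient (coequalizer) of
`s₁, s₂` and `η` the unit of the reflection, `t₁, t₂` is the kernel pair of `q ≫ η_Q`. -/
def IsEffectiveClosure (P : ObjectProperty C) [Reflective P.ι] {S X T : C}
    (s₁ s₂ : S ⟶ X) (t₁ t₂ : T ⟶ X) : Prop :=
  ∃ (Q : C) (q : X ⟶ Q) (hq : s₁ ≫ q = s₂ ≫ q),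
    Nonempty (IsColimit (Cofork.ofπ q hq)) ∧
      IsKernelPair (q ≫ (reflectorAdjunction P.ι).unit.app Q) t₁ t₂

end Categorical

end MaltsevAlg

/-! Everything rests on two consequences of the Mal'tsev term `m`. If `U` is open, `y ∈ U` and `y`
is related to `x`, then for `z` near `x` the point `m z x y` stays in `U` and is related to `m z x x
= z`; so saturations of open sets are open (`isOpen_saturation`). The same manipulation makes
congruences permute (`comp_le_comp`).

Openness makes the quotient by a closed congruence Hausdorff (`exists_quotient`). So congruences are
precisely kernels, regular epimorphisms are precisely surjections, and exactness follows from
pointwise arguments. Surjections are open, so images of clopen sets are clopen and profiniteness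
passes to quotients (`profinite_of_surjective`).

A product of connected sets is connected, so `compRel` is a congruence; the quotient by it is
profinite and universal, hence is the reflection.

For the closure of `S`, permutability makes `S ∘ R_A` a congruence. The quotient `W` of `A` by it is
also a quotient of the profinite `A/R_A`, hence profinite, so `A/S → W` collapses connected
components. This gives the nontrivial inclusion (`compRel_quotient_iff`). -/

namespace MaltsevAlg

open FirstOrder.Language (Term)
open FirstOrder.Language.Structure (funMap)

/-! ### Terms -/

section Terms

variable {Op : ℕ → Type u}

/-- Maps commuting with the operations commute with all terms. -/
theorem map_realize {α : Type*} {M N : Type*} [(opLanguage Op).Structure M]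
    [(opLanguage Op).Structure N] (φ : M → N)
    (hφ : ∀ {n : ℕ} (f : (opLanguage Op).Functions n) (x : Fin n → M),
      φ (funMap f x) = funMap f fun i => φ (x i))
    (t : (opLanguage Op).Term α) (x : α → M) :
    φ (t.realize x) = t.realize fun a => φ (x a) := by
  induction t with
  | var => rfl
  | func f ts ih => simp only [Term.realize_func, hφ, ih]

/-- Relations compatible with the operations are compatible with all terms. -/
theorem rel_realize {α : Type*} {M : Type*} [(opLanguage Op).Structure M] {r : M → M → Prop}
    (hr : ∀ {n : ℕ} (f : (opLanguage Op).Functions n) (x y : Fin n → M),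
      (∀ i, r (x i) (y i)) → r (funMap f x) (funMap f y))
    (t : (opLanguage Op).Term α) {x y : α → M} (h : ∀ a, r (x a) (y a)) :
    r (t.realize x) (t.realize y) := by
  induction t with
  | var a => exact h a
  | func f ts ih => exact hr f _ _ ih

end Terms

namespace CompHausAlg

variable {T : AlgTheory.{u}}

theorem continuous_realize (A : CompHausAlg.{w} T) {α : Type*} (t : T.lang.Term α) :
    Continuous fun x : α → A => t.realize x := by
  induction t with
  | var a => exact continuous_apply a
  | func f ts ih => exact (A.continuous_op f).comp (continuous_pi ih)

/-- Soundness of equational logic. -/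
theorem realize_eq_of_proves (A : CompHausAlg.{w} T) {s t : T.lang.Term ℕ} (h : T.Proves s t)
    (x : ℕ → A) : s.realize x = t.realize x := by
  induction h with
  | ax h σ => simpa only [Term.realize_subst] using A.satisfies _ h _
  | refl => rfl
  | symm _ ih => exact ih.symm
  | trans _ _ ih₁ ih₂ => exact ih₁.trans ih₂
  | congr f _ ih => exact congrArg (funMap f) (funext ih)

/-- The Mal'tsev operation of a compact Hausdorff algebra over a Mal'tsev theory. -/
theorem exists_maltsev (hT : T.IsMaltsev) (A : CompHausAlg.{w} T) :
    ∃ m : A → A → A → A, (∀ y z, Continuous fun x => m x y z) ∧ (∀ x y, m x x y = y) ∧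
      (∀ x y, m x y y = x) ∧ ∀ r, A.IsCongruence r → ∀ {x x' y y' z z'},
        r x x' → r y y' → r z z' → r (m x y z) (m x' y' z') := by
  obtain ⟨p, h₁, h₂⟩ := hT
  refine ⟨fun x y z => p.realize ![x, y, z], fun y z => ?_, fun x y => ?_, fun x y => ?_, ?_⟩
  · refine (A.continuous_realize p).comp (continuous_pi fun i => ?_)
    fin_cases i
    exacts [continuous_id, continuous_const, continuous_const]
  -- Only the variables 0 and 1 occur in the identity, so the value `y` at all other indices is a
  -- dummy.
  · have := A.realize_eq_of_proves h₁ fun n => if n = 0 then x else y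
    rw [Term.realize_subst] at this
    refine Eq.trans (congrArg p.realize (funext fun i => ?_)) this
    fin_cases i <;> simp
  · have := A.realize_eq_of_proves h₂ fun n => if n = 0 then x else y
    rw [Term.realize_subst] at this
    refine Eq.trans (congrArg p.realize (funext fun i => ?_)) this
    fin_cases i <;> simp
  · intro r hr x x' y y' z z' hx hy hz
    refine rel_realize hr.op_compat p fun i => ?_
    fin_cases i
    exacts [hx, hy, hz]

/-! ### Congruences -/

/-- The set of points related to a point of `U` is open when `U` is. -/
theorem IsCongruence.isOpen_saturation (hT : T.IsMaltsev) {A : CompHausAlg.{w} T}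
    {r : A → A → Prop} (h : A.IsCongruence r) {U : Set A} (hU : IsOpen U) :
    IsOpen {x | ∃ y ∈ U, r y x} := by
  obtain ⟨m, hm, hm₁, hm₂, hmr⟩ := A.exists_maltsev hT
  refine isOpen_iff_mem_nhds.2 fun x ⟨y, hyU, hyx⟩ => ?_
  have hV : {z | m z x y ∈ U} ∈ nhds x :=
    (hU.preimage (hm x y)).mem_nhds (by simpa [hm₁] using hyU)
  refine Filter.mem_of_superset hV fun z hz => ⟨_, hz, ?_⟩
  have := hmr r h (h.equivalence.refl z) (h.equivalence.refl x) hyx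
  rwa [hm₂] at this

/-- Congruences permute. -/
theorem IsCongruence.comp_le_comp (hT : T.IsMaltsev) {A : CompHausAlg.{w} T}
    {r s : A → A → Prop} (hr : A.IsCongruence r) (hs : A.IsCongruence s) {x y : A}
    (h : Relation.Comp r s x y) : Relation.Comp s r x y := by
  obtain ⟨m, -, hm₁, hm₂, hmr⟩ := A.exists_maltsev hT
  obtain ⟨z, hxz, hzy⟩ := h
  -- Compare with `x = m x z z`, changing `z` to `y` along `s`, and with `y = m z z y`, changing `x`
  -- to `z` along `r`.
  refine ⟨m x z y, ?_, ?_⟩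
  · have := hmr s hs (hs.equivalence.refl x) (hs.equivalence.refl z) hzy
    rwa [hm₂] at this
  · have := hmr r hr hxz (hr.equivalence.refl z) (hr.equivalence.refl y)
    rwa [hm₁] at this

theorem IsCongruence.comp_comm (hT : T.IsMaltsev) {A : CompHausAlg.{w} T}
    {r s : A → A → Prop} (hr : A.IsCongruence r) (hs : A.IsCongruence s) :
    Relation.Comp r s = Relation.Comp s r := by
  ext x y
  exact ⟨hr.comp_le_comp hT hs, hs.comp_le_comp hT hr⟩

/-- Permutability supplies symmetry and transitivity; closedness holds because the composite is the
projection of a compact subset of `A × A × A`. -/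
theorem IsCongruence.comp (hT : T.IsMaltsev) {A : CompHausAlg.{w} T}
    {r s : A → A → Prop} (hr : A.IsCongruence r) (hs : A.IsCongruence s) :
    A.IsCongruence (Relation.Comp r s) where
  equivalence :=
    { refl := fun x => ⟨x, hr.equivalence.refl x, hs.equivalence.refl x⟩
      symm := fun ⟨z, hxz, hzy⟩ => hs.comp_le_comp hT hr
        ⟨z, hs.equivalence.symm hzy, hr.equivalence.symm hxz⟩
      trans := fun ⟨a, hxa, hay⟩ ⟨b, hyb, hbz⟩ => by
        obtain ⟨c, hac, hcb⟩ := hs.comp_le_comp hT hr ⟨_, hay, hyb⟩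
        exact ⟨c, hr.equivalence.trans hxa hac, hs.equivalence.trans hcb hbz⟩ }
  isClosed := by
    have h₁ : IsClosed {z : A × A × A | r z.1 z.2.1} :=
      hr.isClosed.preimage (f := fun z : A × A × A => (z.1, z.2.1)) (by fun_prop)
    have h₂ : IsClosed {z : A × A × A | s z.2.1 z.2.2} := hs.isClosed.preimage continuous_snd
    convert ((h₁.inter h₂).isCompact.image
      (f := fun z : A × A × A => (z.1, z.2.2)) (by fun_prop)).isClosed using 1
    ext ⟨x, y⟩
    constructor
    · rintro ⟨z, hxz, hzy⟩
      exact ⟨(x, z, y), ⟨hxz, hzy⟩, rfl⟩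
    · rintro ⟨⟨x, z, y⟩, ⟨hxz, hzy⟩, h⟩
      cases h
      exact ⟨z, hxz, hzy⟩
  op_compat f x y h := by
    choose z hxz hzy using h
    exact ⟨_, hr.op_compat f _ _ hxz, hs.op_compat f _ _ hzy⟩

/-- The space of components of a compact Hausdorff space is Hausdorff, so the relation is a preimage
of a closed diagonal. An operation maps a product of components, which is connected, into a single
component. No Mal'tsev term is needed. -/
theorem isCongruence_compRel (A : CompHausAlg.{w} T) : A.IsCongruence A.compRel where
  equivalence := ⟨fun _ => rfl, fun h => h.symm, fun h₁ h₂ => h₁.trans h₂⟩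
  isClosed := by
    convert isClosed_diagonal.preimage
      (ConnectedComponents.continuous_coe.prodMap (ConnectedComponents.continuous_coe (α := A)))
    ext z
    exact ConnectedComponents.coe_eq_coe.symm
  op_compat f x y h := by
    have hc : IsPreconnected (funMap f '' Set.univ.pi fun i => connectedComponent (x i)) :=
      (isPreconnected_univ_pi fun i => isPreconnected_connectedComponent).image _
        (A.continuous_op f).continuousOn
    refine connectedComponent_eq (hc.subset_connectedComponent ?_ ?_)
    · exact ⟨x, fun i _ => mem_connectedComponent, rfl⟩
    · refine ⟨y, fun i _ => ?_, rfl⟩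
      change y i ∈ connectedComponent (x i)
      rw [show connectedComponent (x i) = connectedComponent (y i) from h i]
      exact mem_connectedComponent

/-! ### Morphisms -/

theorem continuous_hom {A B : CompHausAlg.{w} T} (f : A ⟶ B) : Continuous f :=
  Hom.continuous_toFun f

theorem hom_funMap {A B : CompHausAlg.{w} T} (f : A ⟶ B) {n : ℕ} (o : T.lang.Functions n)
    (x : Fin n → A) : f (funMap o x) = funMap o fun i => f (x i) :=
  Hom.map_op f o x

theorem hom_ext {A B : CompHausAlg.{w} T} {f g : A ⟶ B} (h : ∀ x, f x = g x) : f = g :=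
  Hom.ext (funext h)

theorem isQuotientMap_hom {A B : CompHausAlg.{w} T} {f : A ⟶ B} (hf : Function.Surjective f) :
    Topology.IsQuotientMap f :=
  .of_surjective_continuous hf (continuous_hom f)

/-- A bijective morphism is an isomorphism. -/
theorem isIso_of_bijective {A B : CompHausAlg.{w} T} {f : A ⟶ B} (hf : Function.Bijective f) :
    IsIso f := by
  let e := Equiv.ofBijective f hf
  have he : ∀ y, f (e.symm y) = y := e.apply_symm_apply
  let g : B ⟶ A := ⟨e.symm, (continuous_hom f).continuous_symm_of_equiv_compact_to_t2 (f := e),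
    fun o x => hf.1 (by simp only [he, hom_funMap])⟩
  exact ⟨g, hom_ext e.symm_apply_apply, hom_ext he⟩

/-- A morphism that is constant on the fibres of a surjective morphism descends along it. -/
theorem exists_desc {A B C : CompHausAlg.{w} T} {f : A ⟶ B} (hf : Function.Surjective f)
    (k : A ⟶ C) (hk : ∀ x y, f x = f y → k x = k y) : ∃ d : B ⟶ C, f ≫ d = k := by
  let s := Function.surjInv hf
  have hs : ∀ y, f (s y) = y := Function.surjInv_eq hf
  have hd : ∀ x, k (s (f x)) = k x := fun x => hk _ _ (hs _)
  refine ⟨⟨fun y => k (s y), ?_, fun o x => ?_⟩, hom_ext hd⟩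
  · rw [(isQuotientMap_hom hf).continuous_iff]
    convert continuous_hom k using 1
    exact funext hd
  · rw [← hom_funMap]
    exact hk _ _ (by simp only [hs, hom_funMap])

theorem eq_of_surjective {A B C : CompHausAlg.{w} T} {f : A ⟶ B} (hf : Function.Surjective f)
    {g h : B ⟶ C} (e : f ≫ g = f ≫ h) : g = h :=
  hom_ext fun y => by
    obtain ⟨x, rfl⟩ := hf y
    exact ConcreteCategory.congr_hom e x

/-- A surjective morphism is the coequalizer of every pair that generates its kernel. -/
theorem nonempty_isColimit_cofork {R A B : CompHausAlg.{w} T} {p₁ p₂ : R ⟶ A} {f : A ⟶ B}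
    (hf : Function.Surjective f) (w : p₁ ≫ f = p₂ ≫ f)
    (hr : ∀ x y, f x = f y → relOf p₁ p₂ x y) : Nonempty (IsColimit (Cofork.ofπ f w)) := by
  have key : ∀ s : Cofork p₁ p₂, ∃ d : B ⟶ s.pt, f ≫ d = s.π := fun s =>
    exists_desc hf s.π fun x y hxy => by
      obtain ⟨z, rfl, rfl⟩ := hr x y hxy
      exact ConcreteCategory.congr_hom s.condition z
  choose d hd using key
  exact ⟨Cofork.IsColimit.mk _ d hd fun s m hm => eq_of_surjective hf (hm.trans (hd s).symm)⟩

/-! ### Subalgebras of products -/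

/-- The closed subalgebra of `A × B` consisting of the pairs related by `r`. -/
def prodSub (A B : CompHausAlg.{w} T) (r : A → B → Prop)
    (hc : IsClosed {z : A × B | r z.1 z.2})
    (hop : ∀ {n : ℕ} (f : T.lang.Functions n) (x : Fin n → A) (y : Fin n → B),
      (∀ i, r (x i) (y i)) → r (funMap f x) (funMap f y)) : CompHausAlg.{w} T :=
  letI str : T.lang.Structure {z : A × B // r z.1 z.2} :=
    ⟨fun f x => ⟨(funMap f fun i => (x i).1.1, funMap f fun i => (x i).1.2),
      hop f _ _ fun i => (x i).2⟩, fun R => R.elim⟩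
  { carrier := {z : A × B // r z.1 z.2}
    compact := isCompact_iff_compactSpace.1 hc.isCompact
    str := str
    continuous_op := fun f => Continuous.subtype_mk
      (((A.continuous_op f).comp (by fun_prop)).prodMk ((B.continuous_op f).comp (by fun_prop))) _
    satisfies := fun e he x => Subtype.ext <| Prod.ext
      (by
        rw [map_realize (fun z : {z : A × B // r z.1 z.2} => z.1.1) (fun _ _ => rfl),
          map_realize (fun z : {z : A × B // r z.1 z.2} => z.1.1) (fun _ _ => rfl)]
        exact A.satisfies e he _)
      (by
        rw [map_realize (fun z : {z : A × B // r z.1 z.2} => z.1.2) (fun _ _ => rfl),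
          map_realize (fun z : {z : A × B // r z.1 z.2} => z.1.2) (fun _ _ => rfl)]
        exact B.satisfies e he _) }

section ProdSub

variable {A B : CompHausAlg.{w} T} {r : A → B → Prop} (hc : IsClosed {z : A × B | r z.1 z.2})
  (hop : ∀ {n : ℕ} (f : T.lang.Functions n) (x : Fin n → A) (y : Fin n → B),
      (∀ i, r (x i) (y i)) → r (funMap f x) (funMap f y))

/-- The first projection of a subalgebra of a product. -/
def prodSubFst : prodSub A B r hc hop ⟶ A :=
  ⟨fun z => z.1.1, continuous_fst.comp continuous_subtype_val, fun _ _ => rfl⟩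

/-- The second projection of a subalgebra of a product. -/
def prodSubSnd : prodSub A B r hc hop ⟶ B :=
  ⟨fun z => z.1.2, continuous_snd.comp continuous_subtype_val, fun _ _ => rfl⟩

/-- The morphism into a subalgebra of a product with given coordinates. -/
def prodSubLift {S : CompHausAlg.{w} T} (f : S ⟶ A) (g : S ⟶ B) (h : ∀ s, r (f s) (g s)) :
    S ⟶ prodSub A B r hc hop :=
  ⟨fun s => ⟨(f s, g s), h s⟩,
    ((continuous_hom f).prodMk (continuous_hom g)).subtype_mk _,
    fun o x => Subtype.ext (Prod.ext (hom_funMap f o x) (hom_funMap g o x))⟩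

theorem prodSub_isPullback {C : CompHausAlg.{w} T} (f : A ⟶ C) (g : B ⟶ C)
    (hr : ∀ a b, r a b ↔ f a = g b) :
    IsPullback (prodSubFst hc hop) (prodSubSnd hc hop) f g where
  w := hom_ext fun z => (hr _ _).1 z.2
  isLimit' := ⟨PullbackCone.IsLimit.mk _
    (fun s => prodSubLift hc hop s.fst s.snd fun x =>
      (hr _ _).2 (ConcreteCategory.congr_hom s.condition x))
    (fun _ => rfl) (fun _ => rfl)
    (fun _ _ h₁ h₂ => hom_ext fun x => Subtype.ext (Prod.ext
      (ConcreteCategory.congr_hom h₁ x) (ConcreteCategory.congr_hom h₂ x)))⟩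

end ProdSub

theorem exists_isPullback {A B C : CompHausAlg.{w} T} (f : A ⟶ C) (g : B ⟶ C) :
    ∃ (P : CompHausAlg.{w} T) (fst : P ⟶ A) (snd : P ⟶ B), IsPullback fst snd f g ∧
      ∀ a b, f a = g b → ∃ z, fst z = a ∧ snd z = b := by
  refine ⟨prodSub A B (fun a b => f a = g b)
    (isClosed_eq ((continuous_hom f).comp continuous_fst) ((continuous_hom g).comp continuous_snd))
    fun o x y h => by simp only [hom_funMap, h], _, _,
    prodSub_isPullback _ _ f g fun _ _ => Iff.rfl, fun a b h => ⟨⟨(a, b), h⟩, rfl, rfl⟩⟩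

/-- The points of a pullback. -/
theorem exists_of_isPullback {P A B C : CompHausAlg.{w} T} {fst : P ⟶ A} {snd : P ⟶ B}
    {f : A ⟶ C} {g : B ⟶ C} (h : IsPullback fst snd f g) {a : A} {b : B} (hab : f a = g b) :
    ∃ z, fst z = a ∧ snd z = b := by
  obtain ⟨P', fst', snd', h', hP⟩ := exists_isPullback f g
  obtain ⟨z, rfl, rfl⟩ := hP a b hab
  exact ⟨h.lift _ _ h'.w z, ConcreteCategory.congr_hom (h.lift_fst _ _ h'.w) z,
    ConcreteCategory.congr_hom (h.lift_snd _ _ h'.w) z⟩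

theorem relOf_iff_of_isKernelPair {S A B : CompHausAlg.{w} T} {s₁ s₂ : S ⟶ A} {f : A ⟶ B}
    (h : IsKernelPair f s₁ s₂) (x y : A) : relOf s₁ s₂ x y ↔ f x = f y := by
  refine ⟨?_, exists_of_isPullback h⟩
  rintro ⟨s, rfl, rfl⟩
  exact ConcreteCategory.congr_hom h.w s

/-- Joint monicity is tested on the closed subalgebra of `S × S` formed by the pairs that both maps
identify: its two projections must coincide. -/
theorem eq_of_jointlyMono {S A : CompHausAlg.{w} T} {s₁ s₂ : S ⟶ A} (h : JointlyMono₂ s₁ s₂)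
    {x y : S} (h₁ : s₁ x = s₁ y) (h₂ : s₂ x = s₂ y) : x = y := by
  have hc : IsClosed {z : S × S | s₁ z.1 = s₁ z.2 ∧ s₂ z.1 = s₂ z.2} :=
    (isClosed_eq ((continuous_hom s₁).comp continuous_fst)
      ((continuous_hom s₁).comp continuous_snd)).inter
    (isClosed_eq ((continuous_hom s₂).comp continuous_fst)
      ((continuous_hom s₂).comp continuous_snd))
  have hop : ∀ {n : ℕ} (o : T.lang.Functions n) (x y : Fin n → S),
      (∀ i, s₁ (x i) = s₁ (y i) ∧ s₂ (x i) = s₂ (y i)) →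
      s₁ (funMap o x) = s₁ (funMap o y) ∧ s₂ (funMap o x) = s₂ (funMap o y) := fun o x y h => by
    simp only [hom_funMap, h, and_self]
  let r : S → S → Prop := fun x y => s₁ x = s₁ y ∧ s₂ x = s₂ y
  have := h.right_cancellation (prodSubFst (r := r) hc hop) (prodSubSnd (r := r) hc hop)
    (hom_ext fun z => (Subtype.prop z).1) (hom_ext fun z => (Subtype.prop z).2)
  exact ConcreteCategory.congr_hom this ⟨(x, y), h₁, h₂⟩

/-- The terminal algebra. -/
def point : CompHausAlg.{w} T :=
  letI str : T.lang.Structure PUnit.{w + 1} := ⟨fun _ _ => ⟨⟩, fun R => R.elim⟩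
  { carrier := PUnit
    str := str
    continuous_op := fun _ => continuous_const
    satisfies := fun _ _ _ => rfl }

theorem hasFiniteLimits : HasFiniteLimits (CompHausAlg.{w} T) := by
  have : HasTerminal (CompHausAlg.{w} T) :=
    (IsTerminal.ofUniqueHom (Y := point)
      (fun A => (⟨fun _ => ⟨⟩, continuous_const, fun _ _ => rfl⟩ : Hom A point))
      fun _ _ => rfl).hasTerminal
  have : HasPullbacks (CompHausAlg.{w} T) :=
    have (X Y Z : CompHausAlg.{w} T) (f : X ⟶ Z) (g : Y ⟶ Z) : HasLimit (cospan f g) := by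
      obtain ⟨_, _, _, h, -⟩ := exists_isPullback f g
      exact h.hasPullback
    hasPullbacks_of_hasLimit_cospan _
  exact hasFiniteLimits_of_hasTerminal_and_pullbacks

/-! ### Quotients -/

/-- The quotient algebra structure on the target of a surjection whose kernel is compatible with
the operations. -/
noncomputable def image (A : CompHausAlg.{w} T) {X : Type w} [TopologicalSpace X] [T2Space X]
    (π : A → X) (hc : Continuous π) (hs : Function.Surjective π)
    (hop : ∀ {n : ℕ} (f : T.lang.Functions n) (x y : Fin n → A), (∀ i, π (x i) = π (y i)) →
      π (funMap f x) = π (funMap f y)) : CompHausAlg.{w} T :=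
  letI str : T.lang.Structure X :=
    ⟨fun f x => π (funMap f fun i => Function.surjInv hs (x i)), fun R => R.elim⟩
  have hπ : ∀ {n : ℕ} (f : T.lang.Functions n) (x : Fin n → A),
      π (funMap f x) = funMap f fun i => π (x i) := fun f x =>
    hop f _ _ fun i => (Function.surjInv_eq hs _).symm
  { carrier := X
    compact := hs.compactSpace hc
    str := str
    continuous_op := fun {n} f => by
      -- A finite power of `π` is a continuous surjection from a compact space to a Hausdorff one,
      -- so continuity of the operation can be checked upstairs.
      have hq : Topology.IsQuotientMap fun (x : Fin n → A) i => π (x i) :=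
        .of_surjective_continuous
          (fun y => ⟨fun i => Function.surjInv hs (y i), funext fun i => Function.surjInv_eq hs _⟩)
          (by fun_prop)
      rw [hq.continuous_iff]
      convert hc.comp (A.continuous_op f) using 1
      exact funext fun x => (hπ f x).symm
    satisfies := fun e he x => by
      obtain ⟨y, rfl⟩ : ∃ y : ℕ → A, (fun n => π (y n)) = x :=
        ⟨fun n => Function.surjInv hs (x n), funext fun n => Function.surjInv_eq hs _⟩
      rw [← map_realize π hπ, ← map_realize π hπ, A.satisfies e he] }

/-- The quotient of an algebra by a congruence. -/
theorem IsCongruence.exists_quotient (hT : T.IsMaltsev) {A : CompHausAlg.{w} T}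
    {r : A → A → Prop} (h : A.IsCongruence r) :
    ∃ (Q : CompHausAlg.{w} T) (q : A ⟶ Q), Function.Surjective q ∧ ∀ x y, q x = q y ↔ r x y := by
  let σ : Setoid A := ⟨r, h.equivalence⟩
  have hr : ∀ x y : A, (⟦x⟧ : Quotient σ) = ⟦y⟧ ↔ r x y := fun x y => Quotient.eq
  have hopen : IsOpenQuotientMap (Quotient.mk σ) := by
    refine ⟨Quotient.mk_surjective, continuous_quotient_mk', fun U hU => ?_⟩
    rw [← isQuotientMap_quotient_mk'.isOpen_preimage]
    convert h.isOpen_saturation hT hU using 1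
    ext x
    exact exists_congr fun y => and_congr_right fun _ => hr y x
  have : T2Space (Quotient σ) := by
    -- For an open quotient map, closedness of the kernel is equivalent to the target being
    -- Hausdorff.
    rw [t2Space_iff_of_isOpenQuotientMap hopen]
    convert h.isClosed using 1
    ext z
    exact hr _ _
  have hop : ∀ {n : ℕ} (f : T.lang.Functions n) (x y : Fin n → A),
      (∀ i, Quotient.mk σ (x i) = Quotient.mk σ (y i)) →
      Quotient.mk σ (funMap f x) = Quotient.mk σ (funMap f y) := fun f x y hxy =>
    (hr _ _).2 (h.op_compat f x y fun i => (hr _ _).1 (hxy i))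
  exact ⟨A.image (Quotient.mk σ) hopen.continuous hopen.surjective hop,
    ⟨Quotient.mk σ, hopen.continuous, fun f x =>
      hop f _ _ fun i => (Function.surjInv_eq hopen.surjective _).symm⟩, hopen.surjective, hr⟩

theorem isCongruence_ker {A B : CompHausAlg.{w} T} (f : A ⟶ B) :
    A.IsCongruence fun x y => f x = f y where
  equivalence := ⟨fun _ => rfl, fun h => h.symm, fun h₁ h₂ => h₁.trans h₂⟩
  isClosed := isClosed_eq ((continuous_hom f).comp continuous_fst)
    ((continuous_hom f).comp continuous_snd)
  op_compat o x y h := by simp only [hom_funMap, h]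

/-- Surjective morphisms of Mal'tsev algebras are open. -/
theorem isOpenMap_of_surjective (hT : T.IsMaltsev) {A B : CompHausAlg.{w} T} {f : A ⟶ B}
    (hf : Function.Surjective f) : IsOpenMap f := fun U hU => by
  rw [← (isQuotientMap_hom hf).isOpen_preimage]
  exact (isCongruence_ker f).isOpen_saturation hT hU

/-! ### Exactness -/

theorem isRegularEpi_of_surjective {A B : CompHausAlg.{w} T} {f : A ⟶ B}
    (hf : Function.Surjective f) : IsRegularEpi f := by
  obtain ⟨P, p₁, p₂, h, hP⟩ := exists_isPullback f f
  obtain ⟨hl⟩ := nonempty_isColimit_cofork hf h.w hP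
  exact ⟨⟨⟨P, p₁, p₂, h.w, hl⟩⟩⟩

/-- Factor `f` as the quotient `q` by its kernel followed by `m`. The coequalizer property yields a
section of `m`, so `m` is surjective and hence so is `f`. -/
theorem surjective_of_isColimit_cofork (hT : T.IsMaltsev) {R A B : CompHausAlg.{w} T}
    {p₁ p₂ : R ⟶ A} {f : A ⟶ B} {w : p₁ ≫ f = p₂ ≫ f} (h : IsColimit (Cofork.ofπ f w)) :
    Function.Surjective f := by
  obtain ⟨Q, q, hq, hqr⟩ := (isCongruence_ker f).exists_quotient hT
  obtain ⟨m, hm⟩ := exists_desc hq f fun x y => (hqr x y).1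
  have hpq : p₁ ≫ q = p₂ ≫ q := hom_ext fun z =>
    (hqr _ _).2 (ConcreteCategory.congr_hom w z)
  obtain ⟨d, hd⟩ : ∃ d : B ⟶ Q, f ≫ d = q := ⟨_, (Cofork.IsColimit.desc' h q hpq).2⟩
  have hdm : d ≫ m = 𝟙 B := Cofork.IsColimit.hom_ext h (by
    change f ≫ d ≫ m = f ≫ 𝟙 B
    rw [← Category.assoc, hd, hm, Category.comp_id])
  intro y
  obtain ⟨x, hx⟩ := hq (d y)
  refine ⟨x, ?_⟩
  rw [← ConcreteCategory.congr_hom hm x]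
  change m (q x) = y
  rw [hx]
  exact ConcreteCategory.congr_hom hdm y

theorem isRegularEpi_iff_surjective (hT : T.IsMaltsev) {A B : CompHausAlg.{w} T} {f : A ⟶ B} :
    IsRegularEpi f ↔ Function.Surjective f :=
  ⟨fun ⟨⟨h⟩⟩ => surjective_of_isColimit_cofork hT h.isColimit, isRegularEpi_of_surjective⟩

theorem isCongruence_relOf {S A : CompHausAlg.{w} T} {s₁ s₂ : S ⟶ A}
    (h : IsEquivalenceRelation s₁ s₂) : A.IsCongruence (relOf s₁ s₂) := by
  obtain ⟨⟨e⟩⟩ := h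
  refine ⟨⟨fun x => ⟨e.r x, ?_, ?_⟩, ?_, ?_⟩, ?_, ?_⟩
  · exact ConcreteCategory.congr_hom e.reflexivity₁ x
  · exact ConcreteCategory.congr_hom e.reflexivity₂ x
  · rintro _ _ ⟨s, rfl, rfl⟩
    exact ⟨e.s s, ConcreteCategory.congr_hom e.symmetry₁ s,
      ConcreteCategory.congr_hom e.symmetry₂ s⟩
  · rintro _ _ _ ⟨s, rfl, rfl⟩ ⟨t, hst, rfl⟩
    obtain ⟨z, rfl, rfl⟩ := exists_of_isPullback
      (IsPullback.of_isLimit e.isLimit) hst.symm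
    exact ⟨e.t z, ConcreteCategory.congr_hom e.transitivity₁ z,
      ConcreteCategory.congr_hom e.transitivity₂ z⟩
  · convert (isCompact_range
      ((continuous_hom s₁).prodMk (continuous_hom s₂))).isClosed using 1
    ext z
    simp [relOf, Prod.ext_iff]
  · intro n f x y h
    choose s h₁ h₂ using h
    exact ⟨funMap f s, by simp only [hom_funMap, h₁], by simp only [hom_funMap, h₂]⟩

/-- A jointly monic pair is the kernel pair of every morphism whose kernel it represents. -/
theorem isKernelPair_of_relOf {S A B : CompHausAlg.{w} T} {s₁ s₂ : S ⟶ A}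
    (hm : JointlyMono₂ s₁ s₂) {f : A ⟶ B} (h : ∀ x y, f x = f y ↔ relOf s₁ s₂ x y) :
    IsKernelPair f s₁ s₂ := by
  obtain ⟨P, p₁, p₂, hP, hPr⟩ := exists_isPullback f f
  have w : s₁ ≫ f = s₂ ≫ f := hom_ext fun s => (h _ _).2 ⟨s, rfl, rfl⟩
  let k := hP.lift s₁ s₂ w
  have hk₁ : k ≫ p₁ = s₁ := hP.lift_fst _ _ w
  have hk₂ : k ≫ p₂ = s₂ := hP.lift_snd _ _ w
  have hPm : JointlyMono₂ p₁ p₂ := ⟨fun _ _ _ => hP.hom_ext⟩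
  have : IsIso k := by
    refine isIso_of_bijective ⟨fun x y hxy => eq_of_jointlyMono hm ?_ ?_, fun z => ?_⟩
    · rw [← hk₁]; exact congrArg p₁ hxy
    · rw [← hk₂]; exact congrArg p₂ hxy
    · obtain ⟨s, hs₁, hs₂⟩ := (h _ _).1 (ConcreteCategory.congr_hom hP.w z)
      refine ⟨s, eq_of_jointlyMono hPm ?_ ?_⟩
      · rw [← hk₁] at hs₁; exact hs₁
      · rw [← hk₂] at hs₂; exact hs₂
  exact IsPullback.of_iso hP (asIso k).symm (Iso.refl _) (Iso.refl _) (Iso.refl _)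
    (by simp [← hk₁]) (by simp [← hk₂]) (by simp) (by simp)

theorem isExact (hT : T.IsMaltsev) : IsExact (CompHausAlg.{w} T) where
  regular :=
    { toHasFiniteLimits := hasFiniteLimits
      hasCoequalizer_of_isKernelPair := fun {_ _ _ f g₁ g₂} h => by
        obtain ⟨Q, q, hq, hqr⟩ := (isCongruence_ker f).exists_quotient hT
        obtain ⟨hl⟩ := nonempty_isColimit_cofork hq
          (hom_ext fun z => (hqr _ _).2 (ConcreteCategory.congr_hom h.w z))
          fun x y hxy => (relOf_iff_of_isKernelPair h x y).2 ((hqr x y).1 hxy)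
        exact ⟨⟨_, hl⟩⟩
      regularEpiIsStableUnderBaseChange := ⟨fun sq hg => by
        rw [MorphismProperty.regularEpi_iff, isRegularEpi_iff_surjective hT] at hg ⊢
        intro x
        obtain ⟨y, hy⟩ := hg _
        obtain ⟨z, -, hz⟩ := exists_of_isPullback sq hy
        exact ⟨z, hz⟩⟩ }
  effective := fun {R X} p₁ p₂ h => by
    obtain ⟨Q, q, hq, hqr⟩ := (isCongruence_relOf h).exists_quotient hT
    have w : p₁ ≫ q = p₂ ≫ q := hom_ext fun s => (hqr _ _).2 ⟨s, rfl, rfl⟩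
    obtain ⟨⟨e⟩⟩ := h
    -- Reflexivity forces the two legs of a cocone to agree, so the pushout required here is just
    -- the coequalizer.
    have hpush : ∀ s : PushoutCocone p₁ p₂, ∃ d : Q ⟶ s.pt, q ≫ d = s.inl ∧ q ≫ d = s.inr := by
      intro s
      have hs : s.inl = s.inr := by
        have := e.r ≫= s.condition
        simpa only [← Category.assoc, e.reflexivity₁, e.reflexivity₂, Category.id_comp] using this
      obtain ⟨d, hd⟩ := exists_desc hq s.inl fun x y hxy => by
        obtain ⟨z, rfl, rfl⟩ := (hqr x y).1 hxy
        refine (ConcreteCategory.congr_hom s.condition z).trans ?_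
        rw [hs]
        rfl
      exact ⟨d, hd, hd.trans hs⟩
    choose d hd₁ hd₂ using hpush
    exact ⟨⟨{ e with
      B := Q
      π := q
      isKernelPair := isKernelPair_of_relOf e.toJointlyMono₂ hqr
      isPushout := ⟨⟨w⟩, ⟨PushoutCocone.IsColimit.mk _ d hd₁ hd₂ fun s m hm _ =>
        eq_of_surjective hq (hm.trans (hd₁ s).symm)⟩⟩ }⟩⟩

/-! ### Profinite algebras -/

/-- Separate a preimage of `y` from the fibre over `y'` by a clopen set; its image is closed by
compactness and open because `f` is an open map. -/
theorem profinite_of_surjective (hT : T.IsMaltsev) {A B : CompHausAlg.{w} T} {f : A ⟶ B}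
    (hf : Function.Surjective f) (hA : profinite T A) : profinite T B := by
  have : TotallyDisconnectedSpace A := hA
  suffices TotallySeparatedSpace B from
    (inferInstance : TotallyDisconnectedSpace B)
  rw [totallySeparatedSpace_iff_exists_isClopen]
  intro y y' hne
  obtain ⟨x, rfl⟩ := hf y
  obtain ⟨V, hV, hxV, hVU⟩ := compact_exists_isClopen_in_isOpen
    (isOpen_compl_singleton.preimage (continuous_hom f)) (show x ∈ f ⁻¹' {y'}ᶜ from hne)
  refine ⟨f '' V, ⟨(hV.1.isCompact.image (continuous_hom f)).isClosed,
    isOpenMap_of_surjective hT hf V hV.2⟩, ⟨x, hxV, rfl⟩, ?_⟩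
  rintro ⟨z, hz, rfl⟩
  exact hVU hz rfl

theorem compRel_hom {A B : CompHausAlg.{w} T} (f : A ⟶ B) {x y : A} (h : A.compRel x y) :
    B.compRel (f x) (f y) := by
  refine connectedComponent_eq ((continuous_hom f).image_connectedComponent_subset x ⟨y, ?_, rfl⟩)
  rw [show connectedComponent x = connectedComponent y from h]
  exact mem_connectedComponent

theorem eq_of_compRel {A : CompHausAlg.{w} T} (hA : profinite T A) {x y : A}
    (h : A.compRel x y) : x = y := by
  have : TotallyDisconnectedSpace A := hA
  simpa [compRel] using h

/-- The quotient of an algebra by its connected components is profinite. -/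
theorem profinite_of_ker_eq_compRel {A B : CompHausAlg.{w} T} {f : A ⟶ B}
    (hf : Function.Surjective f) (h : ∀ x y, f x = f y ↔ A.compRel x y) : profinite T B := by
  -- `B` is profinite because it injects continuously into the totally disconnected space of
  -- components.
  let g : B → ConnectedComponents A := fun y => (Function.surjInv hf y : A)
  have hgf : ∀ x, g (f x) = x := fun x =>
    ConnectedComponents.coe_eq_coe.2 ((h _ _).1 (Function.surjInv_eq hf _))
  have hg : Continuous g := by
    rw [(isQuotientMap_hom hf).continuous_iff]
    convert ConnectedComponents.continuous_coe (α := A)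
    exact funext hgf
  have hinj : Function.Injective g := by
    intro y y' hyy'
    obtain ⟨x, rfl⟩ := hf y
    obtain ⟨x', rfl⟩ := hf y'
    rw [hgf, hgf] at hyy'
    exact (h _ _).2 (ConnectedComponents.coe_eq_coe.1 hyy')
  refine (totallyDisconnectedSpace_iff_connectedComponent_subsingleton).2 fun y a ha b hb => ?_
  exact hinj ((isPreconnected_connectedComponent.image g hg.continuousOn).subsingleton
    ⟨a, ha, rfl⟩ ⟨b, hb, rfl⟩)

/-- The quotient of an algebra by its connected components. -/
theorem exists_profinite_quotient (hT : T.IsMaltsev) (A : CompHausAlg.{w} T) :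
    ∃ (Q : CompHausAlg.{w} T) (q : A ⟶ Q), profinite T Q ∧ Function.Surjective q ∧
      ∀ x y, q x = q y ↔ A.compRel x y := by
  obtain ⟨Q, q, hq, hqr⟩ := A.isCongruence_compRel.exists_quotient hT
  exact ⟨Q, q, profinite_of_ker_eq_compRel hq hqr, hq, hqr⟩

/-- A morphism to a profinite algebra is constant on components, so it factors uniquely through the
quotient by them. -/
theorem nonempty_reflective (hT : T.IsMaltsev) :
    Nonempty (Reflective (profinite.{w} T).ι) := by
  choose Q q hQ hq hqr using exists_profinite_quotient.{w} hT
  have hbij : ∀ (A : CompHausAlg.{w} T) (B : (profinite.{w} T).FullSubcategory),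
      Function.Bijective fun f : (⟨Q A, hQ A⟩ : (profinite.{w} T).FullSubcategory) ⟶ B =>
        q A ≫ f.hom := by
    refine fun A B => ⟨fun f g hfg => ObjectProperty.hom_ext _ (eq_of_surjective (hq A) hfg),
      fun k => ?_⟩
    obtain ⟨d, hd⟩ := exists_desc (hq A) k fun x y hxy =>
      eq_of_compRel B.property (compRel_hom k ((hqr A x y).1 hxy))
    exact ⟨ObjectProperty.homMk d, hd⟩
  exact ⟨{
    L := _
    adj := Adjunction.adjunctionOfEquivLeft (G := (profinite.{w} T).ι)
      (fun A B => Equiv.ofBijective _ (hbij A B))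
      fun A B B' g h => (Category.assoc (q A) h.hom g.hom).symm }⟩

/-! ### The unit of an arbitrary reflection -/

section Reflection

variable [Reflective (profinite.{w} T).ι]

/-- Morphisms into profinite algebras factor through the unit of the reflection. -/
theorem exists_unit_comp_eq (A : CompHausAlg.{w} T) {B : CompHausAlg.{w} T}
    (hB : profinite T B) (k : A ⟶ B) :
    ∃ d, (reflectorAdjunction (profinite.{w} T).ι).unit.app A ≫ d = k :=
  ⟨_, ((reflectorAdjunction (profinite.{w} T).ι).homEquiv_unit A ⟨B, hB⟩ _).symm.trans
    (((reflectorAdjunction (profinite.{w} T).ι).homEquiv A ⟨B, hB⟩).apply_symm_apply k)⟩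

theorem unit_apply_eq_iff (hT : T.IsMaltsev) (A : CompHausAlg.{w} T) (x y : A) :
    (reflectorAdjunction (profinite.{w} T).ι).unit.app A x =
      (reflectorAdjunction (profinite.{w} T).ι).unit.app A y ↔ A.compRel x y := by
  refine ⟨fun h => ?_, fun h => eq_of_compRel
    ((reflector (profinite.{w} T).ι).obj A).property (compRel_hom _ h)⟩
  obtain ⟨Q, q, hQ, hq, hqr⟩ := exists_profinite_quotient hT A
  obtain ⟨d, rfl⟩ := exists_unit_comp_eq A hQ q
  exact (hqr x y).1 (congrArg d h)

/-- The reflector is arbitrary, so the unit is compared with the concrete quotient `q`: `d` and `m`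
go back and forth, and `d ≫ m` is the identity by uniqueness of factorizations through the unit. -/
theorem unit_surjective (hT : T.IsMaltsev) (A : CompHausAlg.{w} T) :
    Function.Surjective ((reflectorAdjunction (profinite.{w} T).ι).unit.app A) := by
  let adj := reflectorAdjunction (profinite.{w} T).ι
  obtain ⟨Q, q, hQ, hq, hqr⟩ := exists_profinite_quotient hT A
  obtain ⟨d, hd⟩ := exists_unit_comp_eq A hQ q
  obtain ⟨m, hm⟩ := exists_desc hq (adj.unit.app A) fun x y hxy =>
    (unit_apply_eq_iff hT A x y).2 ((hqr x y).1 hxy)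
  have hdm : ObjectProperty.homMk (d ≫ m) = 𝟙 ((reflector (profinite.{w} T).ι).obj A) := by
    apply (adj.homEquiv _ _).injective
    rw [adj.homEquiv_unit, adj.homEquiv_unit]
    change adj.unit.app A ≫ d ≫ m = adj.unit.app A ≫ 𝟙 _
    rw [← Category.assoc, hd, hm, Category.comp_id]
  intro y
  obtain ⟨x, hx⟩ := hq (d y)
  refine ⟨x, ?_⟩
  have h₁ : m (q x) = adj.unit.app A x := ConcreteCategory.congr_hom hm x
  have h₂ : m (d y) = y := ConcreteCategory.congr_hom (congrArg (fun f => f.hom) hdm) y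
  exact h₁.symm.trans ((congrArg m hx).trans h₂)

end Reflection

theorem isBirkhoff_profinite (hT : T.IsMaltsev) : IsBirkhoff (profinite.{w} T) where
  exact := isExact hT
  epireflective :=
    { replete := ⟨fun i hX => profinite_of_surjective hT (f := i.hom)
        (fun y => ⟨i.inv y, ConcreteCategory.congr_hom i.inv_hom_id y⟩) hX⟩
      reflective := nonempty_reflective hT
      unit_regularEpi := fun X => isRegularEpi_of_surjective (unit_surjective hT X) }
  regular_quotient := fun _ hf => profinite_of_surjective hT
    ((isRegularEpi_iff_surjective hT).1 hf)

/-! ### Effective closures -/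

/-- Two points become identified by the quotient map and the reflection exactly when they are
related by the composite of the congruence and the relation of connected components. -/
theorem compRel_quotient_iff (hT : T.IsMaltsev) {A B : CompHausAlg.{w} T} {q : A ⟶ B}
    (hq : Function.Surjective q) {r : A → A → Prop} (hr : A.IsCongruence r)
    (hqr : ∀ x y, q x = q y ↔ r x y) (x y : A) :
    B.compRel (q x) (q y) ↔ Relation.Comp r A.compRel x y := by
  constructor
  · intro h
    obtain ⟨P, p, hP, hp, hpr⟩ := exists_profinite_quotient hT A
    obtain ⟨W, π, hπ, hπr⟩ := (hr.comp hT A.isCongruence_compRel).exists_quotient hT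
    obtain ⟨m, hm⟩ := exists_desc hp π fun a b hab =>
      (hπr a b).2 ⟨a, hr.equivalence.refl a, (hpr a b).1 hab⟩
    obtain ⟨d, hd⟩ := exists_desc hq π fun a b hab =>
      -- `π` descends along both `p` and `q`: along `p` it exhibits `W` as a quotient of a profinite
      -- algebra, along `q` it gives the map that collapses components of `B`.
      (hπr a b).2 ⟨b, (hqr a b).1 hab, rfl⟩
    have hms : Function.Surjective m := fun z => by
      obtain ⟨a, rfl⟩ := hπ z
      exact ⟨p a, ConcreteCategory.congr_hom hm a⟩
    have hW := profinite_of_surjective hT hms hP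
    rw [← hπr, ← hd]
    exact eq_of_compRel hW (compRel_hom d h)
  · rintro ⟨z, hxz, hzy⟩
    rw [(hqr x z).2 hxz]
    exact compRel_hom q hzy

theorem exists_isEffectiveClosure (hT : T.IsMaltsev) [Reflective (profinite.{w} T).ι]
    {S A : CompHausAlg.{w} T} {s₁ s₂ : S ⟶ A} (h : IsEquivalenceRelation s₁ s₂) :
    ∃ (S' : CompHausAlg.{w} T) (t₁ t₂ : S' ⟶ A),
      IsEffectiveClosure (profinite.{w} T) s₁ s₂ t₁ t₂ := by
  obtain ⟨Q, q, hq, hqr⟩ := (isCongruence_relOf h).exists_quotient hT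
  have w : s₁ ≫ q = s₂ ≫ q := hom_ext fun s => (hqr _ _).2 ⟨s, rfl, rfl⟩
  obtain ⟨S', t₁, t₂, hk, -⟩ := exists_isPullback
    (q ≫ (reflectorAdjunction (profinite.{w} T).ι).unit.app Q)
    (q ≫ (reflectorAdjunction (profinite.{w} T).ι).unit.app Q)
  exact ⟨S', t₁, t₂, Q, q, w,
    nonempty_isColimit_cofork hq w fun x y hxy => (hqr x y).1 hxy, hk⟩

theorem relOf_of_isEffectiveClosure (hT : T.IsMaltsev) [Reflective (profinite.{w} T).ι]
    {S S' A : CompHausAlg.{w} T} {s₁ s₂ : S ⟶ A} (h : IsEquivalenceRelation s₁ s₂)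
    {t₁ t₂ : S' ⟶ A} (ht : IsEffectiveClosure (profinite.{w} T) s₁ s₂ t₁ t₂) :
    relOf t₁ t₂ = Relation.Comp (relOf s₁ s₂) A.compRel := by
  obtain ⟨Q, q, w, ⟨hl⟩, hk⟩ := ht
  have hqr : ∀ x y, q x = q y ↔ relOf s₁ s₂ x y := by
    refine fun x y => ⟨fun hxy => ?_, ?_⟩
    -- `q` is any coequalizer; that it identifies no more than `S` does is seen by factoring the
    -- concrete quotient through it.
    · obtain ⟨Q', q', hq', hqr'⟩ := (isCongruence_relOf h).exists_quotient hT
      obtain ⟨d, hd⟩ : ∃ d : Q ⟶ Q', q ≫ d = q' :=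
        ⟨_, (Cofork.IsColimit.desc' hl q'
          (hom_ext fun s => (hqr' _ _).2 ⟨s, rfl, rfl⟩)).2⟩
      rw [← hqr', ← hd]
      exact congrArg d hxy
    · rintro ⟨s, rfl, rfl⟩
      exact ConcreteCategory.congr_hom w s
  ext x y
  rw [relOf_iff_of_isKernelPair hk, ← compRel_quotient_iff hT
    (surjective_of_isColimit_cofork hT hl) (isCongruence_relOf h) hqr]
  exact unit_apply_eq_iff hT Q (q x) (q y)

end CompHausAlg

end MaltsevAlg

theorem mainTheorem4 (T : MaltsevAlg.AlgTheory.{u}) (hT : T.IsMaltsev) :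
    -- profinite algebras are a Birkhoff subcategory of the (exact) category of compact
    -- Hausdorff algebras
    MaltsevAlg.IsBirkhoff (MaltsevAlg.CompHausAlg.profinite.{w} T) ∧
    -- the relation of lying in the same connected component is a congruence
    (∀ A : MaltsevAlg.CompHausAlg.{w} T, A.IsCongruence A.compRel) ∧
    ∀ [Reflective (MaltsevAlg.CompHausAlg.profinite.{w} T).ι] (A : MaltsevAlg.CompHausAlg.{w} T),
      -- the unit of the reflection is the quotient map of `A` by this congruence
      (Topology.IsQuotientMap
          ((reflectorAdjunction (MaltsevAlg.CompHausAlg.profinite.{w} T).ι).unit.app A) ∧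
        ∀ x y : A,
          (reflectorAdjunction (MaltsevAlg.CompHausAlg.profinite.{w} T).ι).unit.app A x =
            (reflectorAdjunction (MaltsevAlg.CompHausAlg.profinite.{w} T).ι).unit.app A y ↔
          A.compRel x y) ∧
      -- the effective closure of an equivalence relation `S` on `A` exists and is `S ∘ R_A`
      ∀ (S : MaltsevAlg.CompHausAlg.{w} T) (s₁ s₂ : S ⟶ A), IsEquivalenceRelation s₁ s₂ →
        (∃ (S' : MaltsevAlg.CompHausAlg.{w} T) (t₁ t₂ : S' ⟶ A),
          MaltsevAlg.IsEffectiveClosure (MaltsevAlg.CompHausAlg.profinite.{w} T) s₁ s₂ t₁ t₂) ∧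
        ∀ (S' : MaltsevAlg.CompHausAlg.{w} T) (t₁ t₂ : S' ⟶ A),
          MaltsevAlg.IsEffectiveClosure (MaltsevAlg.CompHausAlg.profinite.{w} T) s₁ s₂ t₁ t₂ →
          MaltsevAlg.CompHausAlg.relOf t₁ t₂ =
              Relation.Comp (MaltsevAlg.CompHausAlg.relOf s₁ s₂) A.compRel ∧
            MaltsevAlg.CompHausAlg.relOf t₁ t₂ =
              Relation.Comp A.compRel (MaltsevAlg.CompHausAlg.relOf s₁ s₂) := by
  refine ⟨MaltsevAlg.CompHausAlg.isBirkhoff_profinite hT,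
    MaltsevAlg.CompHausAlg.isCongruence_compRel, fun A => ⟨⟨?_, ?_⟩, fun S s₁ s₂ hs => ⟨?_, ?_⟩⟩⟩
  · exact MaltsevAlg.CompHausAlg.isQuotientMap_hom
      (MaltsevAlg.CompHausAlg.unit_surjective hT A)
  · exact MaltsevAlg.CompHausAlg.unit_apply_eq_iff hT A
  · exact MaltsevAlg.CompHausAlg.exists_isEffectiveClosure hT hs
  · intro S' t₁ t₂ ht
    have h := MaltsevAlg.CompHausAlg.relOf_of_isEffectiveClosure hT hs ht
    exact ⟨h, h.trans ((MaltsevAlg.CompHausAlg.isCongruence_relOf hs).comp_comm hT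
      A.isCongruence_compRel)⟩
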